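/- Let $X$ be a measurable space, $Y=\{0,1\}$, let $\mathcal H$ be a non-empty class of measurable functions $h:X\to Y$, and let $\mathcal U:X\to 2^X$ satisfy $x\in\mathcal U(x)$ for all $x\in X$. The robust loss is $\ell^{\mathcal U}(h,x,y)=1$ if $h(z)\neq y$ for some $z\in\mathcal U(x)$, and $0$ otherwise; assume that $\ell^{\mathcal U}(h,\cdot,\cdot)$ is measurable for every $h\in\mathcal H$. For a probability measure $P$ on $X\times Y$ and a sample $S=((x_1,y_1),\dots,(x_n,y_n))$ write $L_P(h)=\mathbb E_{(x,y)\sim P}\,\ell^{\mathcal U}(h,x,y)$, $L_P(\mathcal H)=\inf_{h\in\mathcal H}L_P(h)$ and $L_S(h)=\frac1n\sum_{i=1}^n\ell^{\mathcal U}(h,x_i,y_i)$. Assume the usual regularity condition (automatic for countable $X$ with all subsets measurable) that for every $P$ and $n$ the map $(S,T)\mapsto\sup_{h\in\mathcal H}|L_S(h)-L_T(h)|$ is measurable with respect to the completion of $P^n\otimes P^n$. The margin area of $h$ is $\mathrm{mar}^{\mathcal U}_h=\{(x,y)\in X\times Y : \exists z\in\mathcal U(x),\ h(x)\neq h(z)\}$,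 and the margin class is $\mathcal H^{\mathcal U}_{\mathrm{mar}}=\{\mathrm{mar}^{\mathcal U}_h : h\in\mathcal H\}$. The VC-dimension of a collection $\mathcal G$ of sets is the supremum of the sizes of the sets $B$ such that every $F\subseteq B$ equals $G\cap B$ for some $G\in\mathcal G$; $\mathrm{VC}(\mathcal H)$ is that of the collection $\{h^{-1}(1):h\in\mathcal H\}$. Theorem. There is a universal constant $C>0$ such that the following holds. Suppose $\mathrm{VC}(\mathcal H)<\infty$ and $\mathrm{VC}(\mathcal H^{\mathcal U}_{\mathrm{mar}})<\infty$, and put $D=\mathrm{VC}(\mathcal H)+\mathrm{VC}(\mathcal H^{\mathcal U}_{\mathrm{mar}})$. Then $\mathcal H$ is distribution-free agnostically properly learnable with respect to the robust loss: there are a learner $A$, mapping finite samples to elements of $\mathcal H$, and a function $m:(0,1)^2\to\mathbb N$ with $$m(\epsilon,\delta)\le C\,\frac{D\log D+\log(2/\delta)}{\epsilon^2}\qquad(0\log 0:=0)$$ such that for all $\epsilon,\delta\in(0,1)$, all probability measures $P$ on $X\times Y$ and all $n\ge m(\epsilon,\delta)$, with probability at least $1-\delta$ over an i.i.d. sample $S$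 of size $n$ from $P$, $$L_P(A(S))\le L_P(\mathcal H)+\epsilon .$$ Moreover, robust empirical risk minimizers (learners whose output on every sample $S$ minimizes $L_S$ over $\mathcal H$) exist, and every one of them has this property with the same $m$. (The outer measure of the failure event is at most $\delta$.) -/

import Mathlib

open MeasureTheory

namespace RobustLearning

/-! ### VC-dimension -/

/-- The collection `G` of subsets of `α` shatters `B` if every `F ⊆ B` is of the form `g ∩ B`
with `g ∈ G`. -/
def Shatters {α : Type*} (G : Set (Set α)) (B : Set α) : Prop :=
  ∀ F, F ⊆ B → ∃ g ∈ G, g ∩ B = F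

/-- The VC-dimension of `G`: the supremum of the sizes of the sets that are shattered by `G`. -/
noncomputable def vcDim {α : Type*} (G : Set (Set α)) : ℕ∞ :=
  ⨆ B : {B : Set α // Shatters G B}, B.1.encard

/-! ### Hypotheses, losses and margin areas. The label space is `Bool`. -/

/-- A class of hypotheses viewed as a collection of subsets of `X`, each hypothesis being
identified with its preimage of the label `1`. -/
def asSets {X : Type*} (H : Set (X → Bool)) : Set (Set X) :=
  (fun h => {x | h x = true}) '' H

/-- The margin area of `h` with respect to the perturbation type `U`, as a subset of `X × Y`. -/
def marginArea {X : Type*} (U : X → Set X) (h : X → Bool) : Set (X × Bool) :=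
  {p | ∃ z ∈ U p.1, h p.1 ≠ h z}

/-- The margin class of `H` with respect to `U`. -/
def marginClass {X : Type*} (U : X → Set X) (H : Set (X → Bool)) : Set (Set (X × Bool)) :=
  marginArea U '' H

open Classical in
/-- The adversarially robust loss: `1` if some `z ∈ U x` has `h z ≠ y`, and `0` otherwise. -/
noncomputable def robustLoss {X : Type*} (U : X → Set X) (h : X → Bool) (x : X) (y : Bool) : ℝ :=
  if ∃ z ∈ U x, h z ≠ y then 1 else 0

/-- The expected loss of `h` under the distribution `P`. -/
noncomputable def trueLoss {X : Type*} [MeasurableSpace X] (ℓ : (X → Bool) → X → Bool → ℝ)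
    (P : Measure (X × Bool)) (h : X → Bool) : ℝ :=
  ∫ p, ℓ h p.1 p.2 ∂P

/-- The approximation error of the class `H` under the distribution `P`. -/
noncomputable def approxError {X : Type*} [MeasurableSpace X] (ℓ : (X → Bool) → X → Bool → ℝ)
    (P : Measure (X × Bool)) (H : Set (X → Bool)) : ℝ :=
  ⨅ h : H, trueLoss ℓ P h

/-- The empirical loss of `h` on the sample `S` of size `n`. -/
noncomputable def empLoss {X : Type*} (ℓ : (X → Bool) → X → Bool → ℝ) {n : ℕ}
    (S : Fin n → X × Bool) (h : X → Bool) : ℝ :=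
  (∑ i, ℓ h (S i).1 (S i).2) / n

/-! ### Learners -/

/-- A learner maps a finite sequence of labeled instances to a hypothesis. -/
abbrev Learner (X : Type*) := (n : ℕ) → (Fin n → X × Bool) → (X → Bool)

/-- A learner is proper for `H` if it always outputs an element of `H`. -/
def Learner.IsProper {X : Type*} (A : Learner X) (H : Set (X → Bool)) : Prop :=
  ∀ n S, A n S ∈ H

/-- `A` is an empirical risk minimizer for `H` and the loss `ℓ`: on every sample it outputs an
element of `H` whose empirical loss is smallest among all elements of `H`. -/
def Learner.IsERM {X : Type*} (A : Learner X) (H : Set (X → Bool))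
    (ℓ : (X → Bool) → X → Bool → ℝ) : Prop :=
  A.IsProper H ∧ ∀ n S, ∀ h ∈ H, empLoss ℓ S (A n S) ≤ empLoss ℓ S h

/-- `A` learns `H` agnostically over the set of distributions `Q` with sample size `m`: for all
`ε, δ ∈ (0, 1)`, `P ∈ Q` and `n ≥ m ε δ`, with probability at least `1 - δ` over an iid sample `S`
of size `n` from `P` the hypothesis `A n S` has loss at most `approxError ℓ P H + ε`.
The failure event need not be measurable; it is its outer measure that is bounded by `δ`. -/
def Learner.AgnosticallyLearns {X : Type*} [MeasurableSpace X] (A : Learner X)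
    (H : Set (X → Bool)) (ℓ : (X → Bool) → X → Bool → ℝ) (Q : Set (Measure (X × Bool)))
    (m : ℝ → ℝ → ℕ) : Prop :=
  ∀ ε ∈ Set.Ioo (0 : ℝ) 1, ∀ δ ∈ Set.Ioo (0 : ℝ) 1, ∀ P ∈ Q, ∀ n : ℕ, m ε δ ≤ n →
    (Measure.pi fun _ : Fin n => P) {S | approxError ℓ P H + ε < trueLoss ℓ P (A n S)}
      ≤ ENNReal.ofReal δ

/-- `H` is agnostically properly learnable over `Q` with sample size `m`. -/
def ProperlyLearnableWith {X : Type*} [MeasurableSpace X] (H : Set (X → Bool))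
    (ℓ : (X → Bool) → X → Bool → ℝ) (Q : Set (Measure (X × Bool))) (m : ℝ → ℝ → ℕ) : Prop :=
  ∃ A : Learner X, A.IsProper H ∧ A.AgnosticallyLearns H ℓ Q m

/-- The set of all probability measures over `X × Y` (the distribution-free setting). -/
def allDistributions (X : Type*) [MeasurableSpace X] : Set (Measure (X × Bool)) :=
  {P | IsProbabilityMeasure P}

/-- The usual regularity assumption on a class over an uncountable domain, needed for
uniform deviations over the class to be random variables: the largest difference
`sup_{h ∈ H} |L_S(h) - L_T(h)|` between the empirical losses on two iid samples `S`, `T` of the same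
size is measurable with respect to the completed distribution of `(S, T)`.
It holds automatically if `X` is countable with all subsets measurable. -/
def WellBehaved {X : Type*} [MeasurableSpace X] (H : Set (X → Bool))
    (ℓ : (X → Bool) → X → Bool → ℝ) : Prop :=
  ∀ P : Measure (X × Bool), IsProbabilityMeasure P → ∀ n : ℕ,
    AEMeasurable
      (fun q : (Fin n → X × Bool) × (Fin n → X × Bool) =>
        ⨆ h : H, |empLoss ℓ q.1 (h : X → Bool) - empLoss ℓ q.2 (h : X → Bool)|)
      ((Measure.pi fun _ : Fin n => P).prod (Measure.pi fun _ : Fin n => P))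

end RobustLearning

namespace RobustLearning

/-! Since `x ∈ U x`, a hypothesis errs robustly at `(x, y)` iff `h x ≠ y` or `(x, y)` lies in its
margin area. A loss pattern on k examples is thus a function of two traces, and Sauer-Shelah applied
to each of them leaves at most (k+1)^D patterns (`ncard_robustErr_le`). What remains is uniform
convergence for such a class; an empirical risk minimizer is ε-optimal once all deviations are at
most ε/2 (`trueLoss_le_of_isERM`).

Symmetrization replaces the true loss by the loss on a second sample (`measure_exists_abs_sub_le`).
Exchanging entries at random (`measure_le_of_card_swap_le`) then reduces the claim, for fixed
samples, to counting the signs for which some Rademacher sum is large.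

A union bound over all patterns would cost a factor log n. Chaining (`card_exists_abs_rad_le`)
avoids it: patterns are approximated by nets at Hamming scale 4⁻ʲn, and only increments between
consecutive nets, whose variance decays with j, are bounded. The net sizes come from a packing
argument (`card_le_of_separated`): some k coordinates tell a separated family apart, so it has at
most (k+1)^D members. This gives nets of size (8(D+1)4ʲ)^(2D), whose logarithm is the source of the
D log D in the rate. -/

/-! ### Rademacher sums -/

/-- The Rademacher sum of `a` with signs `σ`, where `true` stands for `+1`. -/
noncomputable def rad {ι : Type*} [Fintype ι] (σ : ι → Bool) (a : ι → ℝ) : ℝ :=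
  ∑ i, (if σ i then 1 else -1) * a i

/-- The real indicator vector of a Boolean vector. -/
def ind {ι : Type*} (f : ι → Bool) (i : ι) : ℝ := if f i then 1 else 0

/-- At most `(k + 1) ^ D` patterns of the vectors in `F` are seen on any `k` coordinates. -/
def PolyGrowth {ι : Type*} (D : ℕ) (F : Finset (ι → Bool)) : Prop :=
  ∀ (k : ℕ) (p : Fin k → ι), (F.image fun f => f ∘ p).card ≤ (k + 1) ^ D

lemma PolyGrowth.mono {ι : Type*} {D : ℕ} {F G : Finset (ι → Bool)} (hF : PolyGrowth D F) (h : G ⊆ F) :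
    PolyGrowth D G := fun k p =>
  (Finset.card_le_card (Finset.image_subset_image h)).trans (hF k p)

section Rademacher

variable {ι : Type*} [Fintype ι]

lemma rad_sub (σ : ι → Bool) (a b : ι → ℝ) : rad σ (a - b) = rad σ a - rad σ b := by
  simp [rad, mul_sub]

lemma rad_neg (σ : ι → Bool) (a : ι → ℝ) : rad σ (-a) = -rad σ a := by
  simp [rad]

lemma sum_sq_ind_sub (f g : ι → Bool) :
    ∑ i, (ind f - ind g) i ^ 2 = (hammingDist f g : ℝ) := by
  rw [hammingDist, Finset.card_eq_sum_ones, Finset.sum_filter]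
  push_cast
  refine Finset.sum_congr rfl fun i _ => ?_
  cases hf : f i <;> cases hg : g i <;> simp [ind, hf, hg]

/-- A separated subfamily of maximum size is a net: an uncovered vector could be added to it. -/
lemma exists_maximal_separated (F : Finset (ι → Bool)) (c : ℝ) (hc : 0 ≤ c) :
    ∃ M ⊆ F, (∀ f ∈ M, ∀ g ∈ M, f ≠ g → c < hammingDist f g) ∧
      ∀ f ∈ F, ∃ g ∈ M, (hammingDist f g : ℝ) ≤ c := by
  classical
  obtain ⟨M, hM, hmax⟩ := Finset.exists_max_image
    (F.powerset.filter fun M => ∀ f ∈ M, ∀ g ∈ M, f ≠ g → c < hammingDist f g) Finset.card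
    ⟨∅, by simp⟩
  rw [Finset.mem_filter, Finset.mem_powerset] at hM
  refine ⟨M, hM.1, hM.2, fun f hf => ?_⟩
  by_contra! hcon
  have hfM : f ∉ M := fun h => by
    have := hcon f h
    simp only [hammingDist_self, Nat.cast_zero] at this
    linarith
  have := hmax (insert f M) (by
    rw [Finset.mem_filter, Finset.mem_powerset]
    refine ⟨Finset.insert_subset hf hM.1, fun a ha b hb hab => ?_⟩
    rcases Finset.mem_insert.1 ha with rfl | ha' <;>
      rcases Finset.mem_insert.1 hb with rfl | hb'
    · exact absurd rfl hab
    · exact hcon b hb'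
    · rw [hammingDist_comm]
      exact hcon a ha'
    · exact hM.2 a ha' b hb' hab)
  rw [Finset.card_insert_of_notMem hfM] at this
  omega

lemma card_agree (k : ℕ) (f g : ι → Bool) :
    (Finset.univ.filter fun p : Fin k → ι => f ∘ p = g ∘ p).card
      = (Fintype.card ι - hammingDist f g) ^ k := by
  classical
  have h : (Finset.univ.filter fun p : Fin k → ι => f ∘ p = g ∘ p)
      = Fintype.piFinset fun _ : Fin k => Finset.univ.filter fun i => f i = g i := by
    ext p
    simp [funext_iff]
  rw [h, Fintype.card_piFinset]
  have h2 : (Finset.univ.filter fun i => f i = g i).card + hammingDist f g = Fintype.card ι := by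
    rw [hammingDist, Finset.card_filter_add_card_filter_not]
    rfl
  simp [← h2]

variable [DecidableEq ι]

lemma sum_exp_rad (a : ι → ℝ) (l : ℝ) :
    ∑ σ : ι → Bool, Real.exp (l * rad σ a) = ∏ i, (2 * Real.cosh (l * a i)) := by
  have h : ∀ i, 2 * Real.cosh (l * a i)
      = ∑ b : Bool, Real.exp (l * ((if b then 1 else -1) * a i)) := by
    intro i
    rw [Real.cosh_eq]
    simp
    ring
  simp_rw [h]
  rw [Finset.prod_univ_sum, Fintype.piFinset_univ]
  refine Finset.sum_congr rfl fun σ _ => ?_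
  rw [rad, Finset.mul_sum, Real.exp_sum]

lemma sum_exp_rad_le (a : ι → ℝ) (l : ℝ) {v : ℝ} (hv : ∑ i, a i ^ 2 ≤ v) :
    ∑ σ : ι → Bool, Real.exp (l * rad σ a)
      ≤ 2 ^ Fintype.card ι * Real.exp (l ^ 2 * v / 2) := by
  rw [sum_exp_rad, Finset.prod_mul_distrib]
  simp only [Finset.prod_const, Finset.card_univ]
  gcongr
  calc ∏ i, Real.cosh (l * a i) ≤ ∏ i, Real.exp ((l * a i) ^ 2 / 2) :=
        Finset.prod_le_prod (fun i _ => (Real.cosh_pos _).le)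
          fun i _ => Real.cosh_le_exp_half_sq _
    _ = Real.exp (l ^ 2 * (∑ i, a i ^ 2) / 2) := by
        rw [← Real.exp_sum]
        congr 1
        rw [Finset.mul_sum, Finset.sum_div]
        exact Finset.sum_congr rfl fun i _ => by ring
    _ ≤ _ := by gcongr

lemma card_le_rad_le (a : ι → ℝ) {v t : ℝ} (hv : ∑ i, a i ^ 2 ≤ v) (hv0 : 0 < v) (ht : 0 ≤ t) :
    ((Finset.univ.filter fun σ : ι → Bool => t ≤ rad σ a).card : ℝ)
      ≤ 2 ^ Fintype.card ι * Real.exp (-(t ^ 2 / (2 * v))) := by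
  -- Chernoff's method with the optimal parameter t/v.
  have h1 : ((Finset.univ.filter fun σ : ι → Bool => t ≤ rad σ a).card : ℝ)
      ≤ ∑ σ : ι → Bool, Real.exp (t / v * rad σ a) * Real.exp (-(t / v * t)) := by
    rw [Finset.card_eq_sum_ones, Finset.sum_filter]
    push_cast
    refine Finset.sum_le_sum fun σ _ => ?_
    split_ifs with h
    · rw [← Real.exp_add]
      apply Real.one_le_exp
      have : t / v * t ≤ t / v * rad σ a := by gcongr
      linarith
    · positivity
  refine h1.trans ?_
  rw [← Finset.sum_mul]
  refine (mul_le_mul_of_nonneg_right (sum_exp_rad_le a (t / v) hv) (Real.exp_pos _).le).trans ?_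
  rw [mul_assoc, ← Real.exp_add]
  apply le_of_eq
  congr 2
  field_simp
  ring

/-- **Hoeffding's inequality** for Rademacher sums, in counting form. -/
lemma card_le_abs_rad_le (a : ι → ℝ) {v t : ℝ} (hv : ∑ i, a i ^ 2 ≤ v) (hv0 : 0 < v)
    (ht : 0 ≤ t) :
    ((Finset.univ.filter fun σ : ι → Bool => t ≤ |rad σ a|).card : ℝ)
      ≤ 2 * (2 ^ Fintype.card ι * Real.exp (-(t ^ 2 / (2 * v)))) := by
  have hsub : (Finset.univ.filter fun σ : ι → Bool => t ≤ |rad σ a|)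
      ⊆ (Finset.univ.filter fun σ : ι → Bool => t ≤ rad σ a)
        ∪ (Finset.univ.filter fun σ : ι → Bool => t ≤ rad σ (-a)) := by
    intro σ hσ
    simp only [Finset.mem_filter, Finset.mem_univ, true_and, Finset.mem_union, rad_neg] at hσ ⊢
    exact le_abs.1 hσ
  have h := (Finset.card_le_card hsub).trans (Finset.card_union_le _ _)
  have h' : ((Finset.univ.filter fun σ : ι → Bool => t ≤ |rad σ a|).card : ℝ)
      ≤ (Finset.univ.filter fun σ : ι → Bool => t ≤ rad σ a).card
        + (Finset.univ.filter fun σ : ι → Bool => t ≤ rad σ (-a)).card := by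
    exact_mod_cast h
  have h1 := card_le_rad_le a hv hv0 ht
  have h2 := card_le_rad_le (-a) (v := v) (by simpa using hv) hv0 ht
  linarith

/-! ### Packing and covering numbers -/

/-- A random choice of `k` coordinates tells apart all vectors of a separated family. -/
lemma exists_injOn_comp {M : Finset (ι → Bool)} {r : ℝ}
    (hM : ∀ f ∈ M, ∀ g ∈ M, f ≠ g → r * Fintype.card ι < hammingDist f g) {k : ℕ}
    (hι : 0 < Fintype.card ι) (hk : (M.card : ℝ) ^ 2 * Real.exp (-(r * k)) < 1) :
    ∃ p : Fin k → ι, Set.InjOn (fun f => f ∘ p) (M : Set (ι → Bool)) := by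
  by_contra! hcon
  -- Union bound over pairs: two vectors further than rN apart, N the number of coordinates, agree
  -- on k random coordinates with probability at most (1 - r)^k ≤ e^(-rk).
  have hsub : (Finset.univ : Finset (Fin k → ι)) ⊆ M.offDiag.biUnion fun q =>
      Finset.univ.filter fun p : Fin k → ι => q.1 ∘ p = q.2 ∘ p := by
    intro p _
    have := hcon p
    simp only [Set.InjOn, not_forall] at this
    obtain ⟨f, hf, g, hg, hfg, hne⟩ := this
    simp only [Finset.mem_biUnion, Finset.mem_offDiag, Finset.mem_filter, Finset.mem_univ,
      true_and]
    exact ⟨(f, g), ⟨hf, hg, hne⟩, hfg⟩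
  have h1 := (Finset.card_le_card hsub).trans Finset.card_biUnion_le
  have hn : (0 : ℝ) < (Fintype.card ι : ℝ) ^ k := by positivity
  have h2 : ((Fintype.card ι : ℝ)) ^ k
      ≤ ∑ q ∈ M.offDiag, Real.exp (-(r * k)) * (Fintype.card ι : ℝ) ^ k := by
    have h1' : ((Fintype.card ι : ℝ)) ^ k ≤ ∑ q ∈ M.offDiag,
        (((Finset.univ.filter fun p : Fin k → ι => q.1 ∘ p = q.2 ∘ p).card : ℕ) : ℝ) := by
      simp only [Finset.card_univ, Fintype.card_fun, Fintype.card_fin] at h1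
      exact_mod_cast h1
    refine h1'.trans (Finset.sum_le_sum fun q hq => ?_)
    rw [Finset.mem_offDiag] at hq
    rw [card_agree]
    have hd := hM _ hq.1 _ hq.2.1 hq.2.2
    have hle : hammingDist q.1 q.2 ≤ Fintype.card ι := hammingDist_le_card_fintype
    push_cast [Nat.cast_sub hle]
    have he : Real.exp (-(r * k)) = Real.exp (-r) ^ k := by
      rw [← Real.exp_nat_mul]
      ring_nf
    rw [he, ← mul_pow]
    have hle' : (hammingDist q.1 q.2 : ℝ) ≤ Fintype.card ι := by exact_mod_cast hle
    refine pow_le_pow_left₀ (by linarith) ?_ k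
    have := Real.one_sub_le_exp_neg r
    have : (1 - r) * Fintype.card ι ≤ Real.exp (-r) * Fintype.card ι := by gcongr
    linarith
  rw [Finset.sum_const, nsmul_eq_mul, ← mul_assoc] at h2
  have h3 : (M.offDiag.card : ℝ) ≤ (M.card : ℝ) ^ 2 := by
    have : M.offDiag.card ≤ M.card ^ 2 := by
      rw [Finset.offDiag_card, sq]
      exact Nat.sub_le _ _
    exact_mod_cast this
  have h4 : (M.offDiag.card : ℝ) * Real.exp (-(r * k)) < 1 :=
    (mul_le_mul_of_nonneg_right h3 (Real.exp_pos _).le).trans_lt hk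
  nlinarith

/-- Coordinates that tell all members apart turn the polynomial bound on patterns into a bound on
the family itself. -/
lemma card_le_of_separated {D : ℕ} {M : Finset (ι → Bool)} (hD : PolyGrowth D M) {r : ℝ}
    (hM : ∀ f ∈ M, ∀ g ∈ M, f ≠ g → r * Fintype.card ι < hammingDist f g) {k : ℕ}
    (hk : (2 * ((k : ℝ) + 1) ^ D) ^ 2 * Real.exp (-(r * k)) < 1) :
    M.card ≤ (k + 1) ^ D := by
  by_contra! hcon
  -- Cutting down to (k+1)^D + 1 ≤ 2(k+1)^D members keeps `hk` independent of the unknown size of M.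
  obtain ⟨M', hM', hcard⟩ := Finset.exists_subset_card_eq (Nat.succ_le_of_lt hcon)
  have hpos : 0 < (k + 1) ^ D := by positivity
  have hι : 0 < Fintype.card ι := by
    obtain ⟨f, hf, g, hg, hne⟩ := Finset.one_lt_card.1 (show 1 < M'.card by omega)
    obtain ⟨i, -⟩ := Function.ne_iff.1 hne
    exact Fintype.card_pos_iff.2 ⟨i⟩
  have hcard' : (M'.card : ℝ) ≤ 2 * ((k : ℝ) + 1) ^ D := by
    have : M'.card ≤ 2 * (k + 1) ^ D := by omega
    exact_mod_cast this
  obtain ⟨p, hp⟩ := exists_injOn_comp (M := M') (k := k)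
    (fun f hf g hg => hM f (hM' hf) g (hM' hg)) hι
    (lt_of_le_of_lt (by gcongr) hk)
  have := hD.mono hM' k p
  rw [Finset.card_image_of_injOn hp] at this
  omega

/-- The bound for the covering numbers at scale `4⁻ʲ`. -/
def coverBound (D j : ℕ) : ℝ := (8 * ((D : ℝ) + 1) * 4 ^ j) ^ (2 * D)

lemma exists_cover {D : ℕ} {F : Finset (ι → Bool)} (hD : PolyGrowth D F) (j : ℕ) :
    ∃ M : Finset (ι → Bool), (M.card : ℝ) ≤ coverBound D j ∧
      ∀ f ∈ F, ∃ g ∈ M, (hammingDist f g : ℝ) ≤ (4 ^ j : ℝ)⁻¹ * Fintype.card ι := by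
  obtain ⟨M, hMF, hsep, hcov⟩ :=
    exists_maximal_separated F ((4 ^ j : ℝ)⁻¹ * Fintype.card ι) (by positivity)
  refine ⟨M, ?_, hcov⟩
  -- With k + 1 = s² the exponent is 8(D+1)s - 4⁻ʲ, while the prefactor has logarithm 2 log 2 + 4D
  -- log s, so the crude bound log s ≤ s - 1 suffices. Also (k+1)^D = s^(2D) is `coverBound D j`.
  obtain ⟨s, hs⟩ : ∃ s : ℕ, s = 8 * (D + 1) * 4 ^ j := ⟨_, rfl⟩
  have h4 : 1 ≤ 4 ^ j := Nat.one_le_pow _ _ (by norm_num)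
  have hs8 : 8 ≤ s := by rw [hs]; nlinarith
  obtain ⟨k, hk⟩ : ∃ k, k + 1 = s ^ 2 := ⟨s ^ 2 - 1, Nat.sub_add_cancel (by nlinarith)⟩
  have hkR : (k : ℝ) + 1 = (s : ℝ) ^ 2 := by exact_mod_cast hk
  have hsR : (s : ℝ) = 8 * ((D : ℝ) + 1) * 4 ^ j := by rw [hs]; push_cast; ring
  have hs8R : (8 : ℝ) ≤ s := by exact_mod_cast hs8
  have h := card_le_of_separated (hD.mono hMF) hsep (k := k) (by
    have hr1 : (4 ^ j : ℝ)⁻¹ ≤ 1 := inv_le_one_of_one_le₀ (by exact_mod_cast h4)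
    have hrs : (4 ^ j : ℝ)⁻¹ * s = 8 * ((D : ℝ) + 1) := by
      rw [hsR]; field_simp
    have hrk : (4 ^ j : ℝ)⁻¹ * k = 8 * ((D : ℝ) + 1) * s - (4 ^ j : ℝ)⁻¹ := by
      rw [← hrs, eq_sub_of_add_eq hkR]; ring
    have hlog : Real.log s ≤ s - 1 := Real.log_le_sub_one_of_pos (by linarith)
    have hlog2 : Real.log 2 ≤ 1 := by linarith [Real.log_two_lt_d9]
    rw [hkR]
    have hpos : (0 : ℝ) < (2 * ((s : ℝ) ^ 2) ^ D) ^ 2 := by positivity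
    rw [← Real.exp_log hpos, ← Real.exp_add, Real.exp_lt_one_iff]
    rw [Real.log_pow, Real.log_mul (by norm_num) (by positivity), Real.log_pow, Real.log_pow, hrk]
    push_cast
    have hDlog : (D : ℝ) * Real.log s ≤ D * (s - 1) := by gcongr
    have hDs : 0 ≤ (D : ℝ) * s := by positivity
    have hD0 : 0 ≤ (D : ℝ) := by positivity
    nlinarith)
  calc (M.card : ℝ) ≤ (((k + 1) ^ D : ℕ) : ℝ) := by exact_mod_cast h
    _ = coverBound D j := by
      push_cast
      rw [hkR, hsR, coverBound, pow_mul]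

end Rademacher

/-! ### Chaining -/

section Chaining

variable {ι : Type*} [Fintype ι] [DecidableEq ι]

/-- The complexity term of the sample size. -/
noncomputable def rateNum (D : ℕ) (δ : ℝ) : ℝ := D * Real.log D + Real.log (2 / δ)

lemma natCast_mul_log_nonneg (D : ℕ) : 0 ≤ (D : ℝ) * Real.log D :=
  mul_nonneg (Nat.cast_nonneg _) (Real.log_natCast_nonneg _)

lemma log_two_div {δ : ℝ} (hδ : 0 < δ) : Real.log (2 / δ) = Real.log 2 - Real.log δ :=
  Real.log_div (by norm_num) hδ.ne'

lemma log_two_le_rateNum (D : ℕ) {δ : ℝ} (hδ0 : 0 < δ) (hδ1 : δ ≤ 1) :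
    Real.log 2 ≤ rateNum D δ := by
  have h1 := natCast_mul_log_nonneg D
  have h2 := Real.log_nonpos hδ0.le hδ1
  rw [rateNum, log_two_div hδ0]
  linarith

lemma neg_log_le_rateNum (D : ℕ) {δ : ℝ} (hδ0 : 0 < δ) :
    Real.log 2 - Real.log δ ≤ rateNum D δ := by
  have h1 := natCast_mul_log_nonneg D
  rw [rateNum, log_two_div hδ0]
  linarith

lemma log_four : Real.log 4 = 2 * Real.log 2 := by
  rw [show (4 : ℝ) = 2 ^ 2 by norm_num, Real.log_pow]
  norm_num

/-- For D ≤ 1 the term D log D vanishes and log(2/δ) ≥ log 2 pays; for D ≥ 2, 8(D+1) ≤ D⁵. -/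
lemma mul_log_le_rateNum (D : ℕ) {δ : ℝ} (hδ0 : 0 < δ) (hδ1 : δ ≤ 1) :
    D * Real.log (8 * ((D : ℝ) + 1)) ≤ 5 * rateNum D δ := by
  have hl2 : 0 < Real.log 2 := Real.log_pos (by norm_num)
  have hB := log_two_le_rateNum D hδ0 hδ1
  rcases Nat.lt_or_ge D 2 with hD | hD
  · interval_cases D
    · simp only [Nat.cast_zero, zero_mul]
      linarith
    · have : Real.log (8 * (((1 : ℕ) : ℝ) + 1)) = 4 * Real.log 2 := by
        rw [show 8 * (((1 : ℕ) : ℝ) + 1) = 2 ^ 4 by norm_num, Real.log_pow]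
        norm_num
      rw [this]
      push_cast
      linarith
  · have hDR : (2 : ℝ) ≤ D := by exact_mod_cast hD
    have h1 : Real.log (8 * ((D : ℝ) + 1)) ≤ 5 * Real.log D := by
      rw [show 5 * Real.log (D : ℝ) = Real.log ((D : ℝ) ^ 5) by rw [Real.log_pow]; norm_num]
      apply Real.log_le_log (by positivity)
      have : (2 : ℝ) ^ 4 ≤ (D : ℝ) ^ 4 := by gcongr
      nlinarith
    have h2 : D * Real.log (8 * ((D : ℝ) + 1)) ≤ D * (5 * Real.log D) := by gcongr
    have h3 : (D : ℝ) * Real.log D ≤ rateNum D δ := by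
      rw [rateNum, log_two_div hδ0]
      have := Real.log_nonpos hδ0.le hδ1
      linarith
    linarith

lemma mul_log_four_le_rateNum (D : ℕ) {δ : ℝ} (hδ0 : 0 < δ) (hδ1 : δ ≤ 1) :
    D * Real.log 4 ≤ 2 * rateNum D δ := by
  have hl2 : 0 < Real.log 2 := Real.log_pos (by norm_num)
  have hB := log_two_le_rateNum D hδ0 hδ1
  rw [log_four]
  rcases Nat.lt_or_ge D 2 with hD | hD
  · interval_cases D <;> push_cast <;> linarith
  · have hDR : (2 : ℝ) ≤ D := by exact_mod_cast hD
    have h1 : Real.log 2 ≤ Real.log D := Real.log_le_log (by norm_num) hDR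
    have h2 : D * Real.log 2 ≤ D * Real.log (D : ℝ) := by gcongr
    have h3 : (D : ℝ) * Real.log D ≤ rateNum D δ := by
      rw [rateNum, log_two_div hδ0]
      have := Real.log_nonpos hδ0.le hδ1
      linarith
    linarith

lemma coverBound_mono (D : ℕ) {i j : ℕ} (h : i ≤ j) : coverBound D i ≤ coverBound D j := by
  unfold coverBound
  gcongr
  norm_num

lemma one_le_coverBound (D j : ℕ) : 1 ≤ coverBound D j := by
  apply one_le_pow₀
  have h4 : (1 : ℝ) ≤ 4 ^ j := one_le_pow₀ (by norm_num)
  have hD : (0 : ℝ) ≤ D := by positivity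
  nlinarith

/-- The total failure probability of the links of the chain between levels `j` and `j + 1`. -/
lemma level_bound (D : ℕ) {δ x : ℝ} (hδ0 : 0 < δ) (hδ1 : δ ≤ 1)
    (hx : 7680 * rateNum D δ ≤ x) (j : ℕ) :
    coverBound D (j + 1) ^ 2 * (2 * Real.exp (-(x * (9 / 4) ^ j / 256)))
      ≤ δ * (1 / 2) ^ (j + 1) := by
  have hl2 : 0 < Real.log 2 := Real.log_pos (by norm_num)
  have hB := log_two_le_rateNum D hδ0 hδ1
  have hB0 : 0 < rateNum D δ := hl2.trans_le hB
  -- Bernoulli: the geometric gain in the exponent dominates the logarithm of the net sizes, which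
  -- is linear in j.
  have hj : (j : ℝ) + 1 ≤ (9 / 4 : ℝ) ^ j := by
    have := one_add_mul_le_pow (show (-2 : ℝ) ≤ 5 / 4 by norm_num) j
    have hj0 : (0 : ℝ) ≤ j := by positivity
    norm_num at this ⊢
    linarith
  have hxj : 7680 * rateNum D δ * ((j : ℝ) + 1) ≤ x * (9 / 4 : ℝ) ^ j := by
    have : 0 ≤ 7680 * rateNum D δ := by positivity
    gcongr
    exact this.trans hx
  have hpos : 0 < coverBound D (j + 1) := lt_of_lt_of_le one_pos (one_le_coverBound _ _)
  have hlhs : coverBound D (j + 1) ^ 2 * (2 * Real.exp (-(x * (9 / 4) ^ j / 256)))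
      = Real.exp (2 * Real.log (coverBound D (j + 1)) + (Real.log 2
        + -(x * (9 / 4) ^ j / 256))) := by
    rw [Real.exp_add, Real.exp_add, Real.exp_log two_pos, mul_comm 2 (Real.log _),
      Real.exp_mul, Real.exp_log hpos]
    norm_num
  have hrhs : δ * (1 / 2) ^ (j + 1)
      = Real.exp (Real.log δ - ((j : ℝ) + 1) * Real.log 2) := by
    rw [sub_eq_add_neg, Real.exp_add, Real.exp_log hδ0, ← mul_neg, ← Real.log_inv, mul_comm _ (Real.log _),
      Real.exp_mul, Real.exp_log (by norm_num)]
    norm_cast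
    norm_num
  rw [hlhs, hrhs, Real.exp_le_exp]
  have hlog : Real.log (coverBound D (j + 1)) = 2 * (D * Real.log (8 * ((D : ℝ) + 1)))
      + 2 * ((j : ℝ) + 1) * (D * Real.log 4) := by
    rw [coverBound, Real.log_pow, Real.log_mul (by positivity) (by positivity), Real.log_pow]
    push_cast
    ring
  rw [hlog]
  -- With R = `rateNum D δ`, the terms to be absorbed add up to at most 21R + 9(j+1)R ≤ 30(j+1)R,
  -- and 7680 = 30 · 256.
  have h1 := mul_log_le_rateNum D hδ0 hδ1
  have h2 : ((j : ℝ) + 1) * (D * Real.log 4) ≤ ((j : ℝ) + 1) * (2 * rateNum D δ) := by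
    exact mul_le_mul_of_nonneg_left (mul_log_four_le_rateNum D hδ0 hδ1) (by positivity)
  have h3 := neg_log_le_rateNum D hδ0
  have h4 : ((j : ℝ) + 1) * Real.log 2 ≤ ((j : ℝ) + 1) * rateNum D δ := by gcongr
  have h5 : 0 ≤ (j : ℝ) * rateNum D δ := by positivity
  nlinarith

/-- The failure count of a single link. -/
lemma card_link_le (f g : ι → Bool) {ε : ℝ} (hε : 0 < ε) (hι : 0 < Fintype.card ι) (j : ℕ)
    (hfg : (hammingDist f g : ℝ) ≤ 2 * (4 ^ j : ℝ)⁻¹ * Fintype.card ι) :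
    ((Finset.univ.filter fun σ : ι → Bool =>
        ε * Fintype.card ι / 8 * (3 / 4) ^ j ≤ |rad σ (ind f - ind g)|).card : ℝ)
      ≤ 2 ^ Fintype.card ι
        * (2 * Real.exp (-(ε ^ 2 * Fintype.card ι * (9 / 4) ^ j / 256))) := by
  have h := card_le_abs_rad_le (ind f - ind g) (v := 2 * (4 ^ j : ℝ)⁻¹ * Fintype.card ι)
    (t := ε * Fintype.card ι / 8 * (3 / 4) ^ j)
    (by rw [sum_sq_ind_sub]; exact hfg) (by positivity) (by positivity)
  refine h.trans (le_of_eq ?_)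
  have hn : (Fintype.card ι : ℝ) ≠ 0 := by positivity
  -- Squared thresholds shrink by 9/16 per level and variances by 1/4, so the exponent grows by 9/4.
  have he : (ε * Fintype.card ι / 8 * (3 / 4) ^ j) ^ 2
        / (2 * (2 * (4 ^ j : ℝ)⁻¹ * Fintype.card ι))
      = ε ^ 2 * Fintype.card ι * (9 / 4) ^ j / 256 := by
    have : (9 / 4 : ℝ) ^ j = ((3 / 4) ^ j) ^ 2 * 4 ^ j := by
      rw [← pow_mul, mul_comm j 2, pow_mul, ← mul_pow]
      norm_num
    rw [this]
    field_simp
    norm_num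
  rw [he]
  ring

/-- **Chaining bound** for Rademacher sums over a family of Boolean vectors with polynomial
growth. -/
theorem card_exists_abs_rad_le {D : ℕ} {F : Finset (ι → Bool)} (hF : PolyGrowth D F) {ε δ : ℝ}
    (hε : 0 < ε) (hδ0 : 0 < δ) (hδ1 : δ ≤ 1)
    (hn : 7680 * rateNum D δ ≤ ε ^ 2 * Fintype.card ι) :
    ((Finset.univ.filter fun σ : ι → Bool =>
        ∃ f ∈ F, ε * Fintype.card ι ≤ |rad σ (ind f)|).card : ℝ)
      ≤ δ * 2 ^ Fintype.card ι := by
  have hι : 0 < Fintype.card ι := by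
    have hB : 0 < rateNum D δ :=
      (Real.log_pos (by norm_num)).trans_le (log_two_le_rateNum D hδ0 hδ1)
    rcases Nat.eq_zero_or_pos (Fintype.card ι) with h | h
    · rw [h] at hn
      norm_num at hn
      linarith
    · exact h
  have hN : (0 : ℝ) < Fintype.card ι := by exact_mod_cast hι
  -- The nets of the chain; the coarsest one consists of the zero vector.
  have hnet : ∀ j : ℕ, ∃ M : Finset (ι → Bool), (M.card : ℝ) ≤ coverBound D j ∧
      (∀ f ∈ F, ∃ g ∈ M, (hammingDist f g : ℝ) ≤ (4 ^ j : ℝ)⁻¹ * Fintype.card ι) ∧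
      (j = 0 → M = {fun _ => false}) := by
    intro j
    rcases Nat.eq_zero_or_pos j with rfl | hj
    · refine ⟨{fun _ => false}, by simpa using one_le_coverBound D 0, fun f _ =>
        ⟨_, Finset.mem_singleton_self _, ?_⟩, fun _ => rfl⟩
      simpa using (hammingDist_le_card_fintype (x := f) (y := fun _ => false))
    · obtain ⟨M, h1, h2⟩ := exists_cover hF j
      exact ⟨M, h1, h2, fun h => by omega⟩
  choose M hMcard hMcov hM0 using hnet
  -- The projection is made total; its values outside F are junk.
  have hproj : ∀ f : ι → Bool, ∀ j, ∃ g, f ∈ F → g ∈ M j ∧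
      (hammingDist f g : ℝ) ≤ (4 ^ j : ℝ)⁻¹ * Fintype.card ι := by
    intro f j
    by_cases hf : f ∈ F
    · obtain ⟨g, hg⟩ := hMcov j f hf
      exact ⟨g, fun _ => hg⟩
    · exact ⟨f, fun h => absurd h hf⟩
  choose π hπ using hproj
  -- At level J the covering radius is below 1, so the chain ends at f itself.
  obtain ⟨J, hJ⟩ : ∃ J : ℕ, (Fintype.card ι : ℝ) < 4 ^ J :=
    pow_unbounded_of_one_lt _ (by norm_num)
  have hπJ : ∀ f ∈ F, π f J = f := by
    intro f hf
    have h := (hπ f J hf).2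
    have h1 : (4 ^ J : ℝ)⁻¹ * Fintype.card ι < 1 := by
      rw [inv_mul_lt_one₀ (by positivity)]
      exact hJ
    have h2 : hammingDist f (π f J) < 1 := by exact_mod_cast h.trans_lt h1
    exact (hammingDist_eq_zero.1 (by omega)).symm
  -- As the powers of 3/4 sum to at most 4, these thresholds sum to at most half of the deviation to
  -- be excluded.
  set t : ℕ → ℝ := fun j => ε * Fintype.card ι / 8 * (3 / 4) ^ j with ht
  set P : ℕ → Finset ((ι → Bool) × (ι → Bool)) := fun j =>
    (M (j + 1) ×ˢ M j).filter fun q =>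
      (hammingDist q.1 q.2 : ℝ) ≤ 2 * (4 ^ j : ℝ)⁻¹ * Fintype.card ι with hP
  -- If every link stays below its threshold, telescoping from the zero vector to f contradicts the
  -- large sum.
  have hsub : (Finset.univ.filter fun σ : ι → Bool =>
      ∃ f ∈ F, ε * Fintype.card ι ≤ |rad σ (ind f)|)
      ⊆ (Finset.range J).biUnion fun j => (P j).biUnion fun q =>
        Finset.univ.filter fun σ : ι → Bool => t j ≤ |rad σ (ind q.1 - ind q.2)| := by
    intro σ hσ
    simp only [Finset.mem_filter, Finset.mem_univ, true_and] at hσ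
    obtain ⟨f, hf, hle⟩ := hσ
    by_contra hcon
    simp only [Finset.mem_biUnion, Finset.mem_range, Finset.mem_filter, Finset.mem_univ,
      true_and, not_exists, not_and, not_le] at hcon
    have hlink : ∀ j ∈ Finset.range J,
        |rad σ (ind (π f (j + 1))) - rad σ (ind (π f j))| ≤ t j := by
      intro j hj
      rw [← rad_sub]
      refine (hcon j (Finset.mem_range.1 hj) (π f (j + 1), π f j) ?_).le
      simp only [hP, Finset.mem_filter, Finset.mem_product]
      refine ⟨⟨(hπ f _ hf).1, (hπ f _ hf).1⟩, ?_⟩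
      have h1 := (hπ f (j + 1) hf).2
      have h2 := (hπ f j hf).2
      have h3 : (hammingDist (π f (j + 1)) (π f j) : ℝ)
          ≤ hammingDist f (π f (j + 1)) + hammingDist f (π f j) := by
        rw [hammingDist_comm f (π f (j + 1))]
        exact_mod_cast hammingDist_triangle _ _ _
      have h4 : (4 ^ (j + 1) : ℝ)⁻¹ * Fintype.card ι ≤ (4 ^ j : ℝ)⁻¹ * Fintype.card ι := by
        gcongr
        · norm_num
        · omega
      linarith
    have h0 : π f 0 = fun _ => false := by
      have := (hπ f 0 hf).1
      rwa [hM0 0 rfl, Finset.mem_singleton] at this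
    have hz : rad σ (ind (π f 0)) = 0 := by
      rw [h0]
      simp [rad, ind]
    have hsum := Finset.sum_range_sub (fun j => rad σ (ind (π f j))) J
    rw [hπJ f hf, hz, sub_zero] at hsum
    have hfin : |rad σ (ind f)| ≤ ∑ j ∈ Finset.range J, t j := by
      rw [← hsum]
      exact (Finset.abs_sum_le_sum_abs _ _).trans (Finset.sum_le_sum hlink)
    have hgeo : ∑ j ∈ Finset.range J, t j ≤ ε * Fintype.card ι / 2 := by
      rw [ht, ← Finset.mul_sum, geom_sum_eq (by norm_num)]
      have : (0 : ℝ) ≤ (3 / 4) ^ J := by positivity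
      have h' : ((3 / 4 : ℝ) ^ J - 1) / (3 / 4 - 1) ≤ 4 := by
        rw [div_le_iff_of_neg (by norm_num)]
        linarith
      calc _ ≤ ε * Fintype.card ι / 8 * 4 := by gcongr
        _ = _ := by ring
    have : 0 < ε * Fintype.card ι := by positivity
    linarith
  have hcount : ∀ j, (((P j).biUnion fun q => Finset.univ.filter fun σ : ι → Bool =>
      t j ≤ |rad σ (ind q.1 - ind q.2)|).card : ℝ)
        ≤ 2 ^ Fintype.card ι * (δ * (1 / 2) ^ (j + 1)) := by
    intro j
    have h1 : (((P j).biUnion fun q => Finset.univ.filter fun σ : ι → Bool =>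
        t j ≤ |rad σ (ind q.1 - ind q.2)|).card : ℝ)
        ≤ ∑ q ∈ P j, ((Finset.univ.filter fun σ : ι → Bool =>
          t j ≤ |rad σ (ind q.1 - ind q.2)|).card : ℝ) := by
      exact_mod_cast Finset.card_biUnion_le
    have h2 : ((P j).card : ℝ) ≤ coverBound D (j + 1) ^ 2 := by
      have : (P j).card ≤ (M (j + 1)).card * (M j).card := by
        rw [← Finset.card_product]
        exact Finset.card_filter_le _ _
      calc ((P j).card : ℝ) ≤ (M (j + 1)).card * (M j).card := by exact_mod_cast this
        _ ≤ coverBound D (j + 1) * coverBound D (j + 1) := by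
          have h0 : 0 ≤ coverBound D (j + 1) := zero_le_one.trans (one_le_coverBound _ _)
          gcongr
          · exact hMcard _
          · exact (hMcard j).trans (coverBound_mono D (Nat.le_succ j))
        _ = _ := by ring
    calc _ ≤ _ := h1
      _ ≤ ∑ q ∈ P j, (2 : ℝ) ^ Fintype.card ι
          * (2 * Real.exp (-(ε ^ 2 * Fintype.card ι * (9 / 4) ^ j / 256))) :=
        Finset.sum_le_sum fun q hq => card_link_le _ _ hε hι j (Finset.mem_filter.1 hq).2
      _ = 2 ^ Fintype.card ι * ((P j).card
          * (2 * Real.exp (-(ε ^ 2 * Fintype.card ι * (9 / 4) ^ j / 256)))) := by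
        rw [Finset.sum_const, nsmul_eq_mul]
        ring
      _ ≤ 2 ^ Fintype.card ι * (coverBound D (j + 1) ^ 2
          * (2 * Real.exp (-(ε ^ 2 * Fintype.card ι * (9 / 4) ^ j / 256)))) := by gcongr
      _ ≤ _ := by
        exact mul_le_mul_of_nonneg_left (level_bound D hδ0 hδ1 hn j) (by positivity)
  have htotal : ((Finset.univ.filter fun σ : ι → Bool =>
      ∃ f ∈ F, ε * Fintype.card ι ≤ |rad σ (ind f)|).card : ℝ)
      ≤ ∑ j ∈ Finset.range J, 2 ^ Fintype.card ι * (δ * (1 / 2) ^ (j + 1)) := by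
    refine le_trans ?_ (Finset.sum_le_sum fun j _ => hcount j)
    exact_mod_cast (Finset.card_le_card hsub).trans Finset.card_biUnion_le
  refine htotal.trans ?_
  have hg : ∑ j ∈ Finset.range J, (1 / 2 : ℝ) ^ (j + 1) ≤ 1 := by
    simp_rw [pow_succ]
    rw [← Finset.sum_mul, geom_sum_eq (by norm_num)]
    have : (0 : ℝ) ≤ (1 / 2) ^ J := by positivity
    have h' : ((1 / 2 : ℝ) ^ J - 1) / (1 / 2 - 1) ≤ 2 := by
      rw [div_le_iff_of_neg (by norm_num)]
      linarith
    linarith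
  rw [← Finset.mul_sum, ← Finset.mul_sum]
  have : (0 : ℝ) ≤ 2 ^ Fintype.card ι * δ := by positivity
  nlinarith

end Chaining

/-! ### Growth functions -/

lemma sum_choose_le_pow (k d : ℕ) : ∑ i ∈ Finset.Iic d, k.choose i ≤ (k + 1) ^ d := by
  rw [add_pow, ← Nat.range_succ_eq_Iic]
  refine Finset.sum_le_sum fun i hi => ?_
  have hi' : i ≤ d := Nat.lt_succ_iff.1 (Finset.mem_range.1 hi)
  calc k.choose i ≤ k ^ i := Nat.choose_le_pow k i
    _ ≤ k ^ i * 1 ^ (d - i) * d.choose i := by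
      rw [one_pow, mul_one]
      exact Nat.le_mul_of_pos_right _ (Nat.choose_pos hi')

lemma encard_le_vcDim {α : Type*} {G : Set (Set α)} {B : Set α} (h : Shatters G B) :
    B.encard ≤ vcDim G :=
  le_iSup (fun B : {B : Set α // Shatters G B} => B.1.encard) ⟨B, h⟩

open Classical in
/-- The **Sauer-Shelah lemma** for the traces of `G` on a tuple of points. -/
lemma ncard_trace_le {α : Type*} {G : Set (Set α)} {d : ℕ} (hd : vcDim G ≤ d) {k : ℕ}
    (w : Fin k → α) :
    ((fun g : Set α => fun i => decide (w i ∈ g)) '' G).ncard ≤ (k + 1) ^ d := by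
  set tr : Set α → Finset (Fin k) := fun g => Finset.univ.filter fun i => w i ∈ g with htr
  set A : Finset (Finset (Fin k)) := (Set.toFinite (tr '' G)).toFinset with hA
  have hmem : ∀ a, a ∈ A ↔ ∃ g ∈ G, tr g = a := by
    intro a
    simp [hA]
  have hcard : ((fun g : Set α => fun i => decide (w i ∈ g)) '' G).ncard ≤ A.card := by
    have himg : ((fun g : Set α => fun i => decide (w i ∈ g)) '' G)
        ⊆ (fun (a : Finset (Fin k)) i => decide (i ∈ a)) '' (A : Set (Finset (Fin k))) := by
      rintro _ ⟨g, hg, rfl⟩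
      refine ⟨tr g, (hmem _).2 ⟨g, hg, rfl⟩, ?_⟩
      simp [htr]
    refine (Set.ncard_le_ncard himg (Set.toFinite _)).trans ?_
    refine (Set.ncard_image_le (Set.toFinite _)).trans ?_
    rw [Set.ncard_coe_finset]
  have hvc : A.vcDim ≤ d := by
    refine Finset.sup_le fun s hs => ?_
    rw [Finset.mem_shatterer] at hs
    -- The tuple may repeat points, but not on a shattered index set: the trace {i} separates i from
    -- every other index of s.
    have hinj : Set.InjOn w (s : Set (Fin k)) := by
      intro i hi j hj hij
      obtain ⟨a, ha, has⟩ := hs (Finset.singleton_subset_iff.2 hi)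
      obtain ⟨g, -, rfl⟩ := (hmem a).1 ha
      have h1 : i ∈ s ∩ tr g := by rw [has]; exact Finset.mem_singleton_self i
      have h2 : w i ∈ g := by simpa [htr] using (Finset.mem_inter.1 h1).2
      have h3 : j ∈ s ∩ tr g := by
        refine Finset.mem_inter.2 ⟨hj, ?_⟩
        simpa [htr] using hij ▸ h2
      rw [has, Finset.mem_singleton] at h3
      exact h3.symm
    have hsh : Shatters G (w '' s) := by
      intro F hF
      obtain ⟨a, ha, has⟩ := hs (Finset.filter_subset (fun i => w i ∈ F) s)
      obtain ⟨g, hg, rfl⟩ := (hmem a).1 ha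
      refine ⟨g, hg, ?_⟩
      have key : ∀ i ∈ s, (w i ∈ g ↔ w i ∈ F) := by
        intro i hi
        have := Finset.ext_iff.1 has i
        simpa [htr, hi] using this
      ext x
      constructor
      · rintro ⟨hxg, i, hi, rfl⟩
        exact (key i hi).1 hxg
      · intro hx
        obtain ⟨i, hi, rfl⟩ := hF hx
        exact ⟨(key i hi).2 hx, i, hi, rfl⟩
    have h := (encard_le_vcDim hsh).trans hd
    rw [hinj.encard_image, Set.encard_coe_eq_coe_finsetCard] at h
    exact_mod_cast h
  calc _ ≤ A.card := hcard
    _ ≤ A.shatterer.card := A.card_le_card_shatterer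
    _ ≤ ∑ i ∈ Finset.Iic A.vcDim, (Fintype.card (Fin k)).choose i :=
      Finset.card_shatterer_le_sum_vcDim
    _ ≤ ∑ i ∈ Finset.Iic d, (Fintype.card (Fin k)).choose i :=
      Finset.sum_le_sum_of_subset (Finset.Iic_subset_Iic.2 hvc)
    _ ≤ (k + 1) ^ d := by
      rw [Fintype.card_fin]
      exact sum_choose_le_pow k d

open Classical in
/-- The robust loss as a Boolean. -/
noncomputable def robustErr {X : Type*} (U : X → Set X) (h : X → Bool) (p : X × Bool) : Bool :=
  decide (∃ z ∈ U p.1, h z ≠ p.2)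

lemma robustLoss_eq {X : Type*} (U : X → Set X) (h : X → Bool) (p : X × Bool) :
    robustLoss U h p.1 p.2 = if robustErr U h p then 1 else 0 := by
  classical
  by_cases hp : ∃ z ∈ U p.1, h z ≠ p.2
  · rw [robustLoss, robustErr, if_pos hp, if_pos (by simpa using hp)]
  · rw [robustLoss, robustErr, if_neg hp, if_neg (by simpa using hp)]

-- If h is correct at x itself, an error at z ∈ U x means h x ≠ h z; conversely, on the margin h x
-- and h z cannot both equal the label.
open Classical in
lemma robustErr_eq {X : Type*} {U : X → Set X} (hU : ∀ x, x ∈ U x) (h : X → Bool)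
    (p : X × Bool) :
    robustErr U h p
      = ((h p.1 ^^ p.2) || decide (p ∈ marginArea U h)) := by
  have hiff : (∃ z ∈ U p.1, h z ≠ p.2) ↔ (h p.1 ≠ p.2 ∨ ∃ z ∈ U p.1, h p.1 ≠ h z) := by
    constructor
    · rintro ⟨z, hz, hne⟩
      by_cases hp : h p.1 = p.2
      · exact Or.inr ⟨z, hz, fun heq => hne (heq.symm.trans hp)⟩
      · exact Or.inl hp
    · rintro (hne | ⟨z, hz, hne⟩)
      · exact ⟨p.1, hU _, hne⟩
      · by_cases hp : h p.1 = p.2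
        · exact ⟨z, hz, fun heq => hne (hp.trans heq.symm)⟩
        · exact ⟨p.1, hU _, hp⟩
  rw [Bool.eq_iff_iff, Bool.or_eq_true, robustErr, decide_eq_true_iff, hiff, decide_eq_true_iff]
  refine or_congr ?_ Iff.rfl
  exact (bne_iff_ne (a := h p.1) (b := p.2)).symm

/-- The number of loss patterns of `H` on `k` examples is polynomial in `k`. -/
lemma ncard_robustErr_le {X : Type*} {U : X → Set X} (hU : ∀ x, x ∈ U x) {H : Set (X → Bool)}
    {D : ℕ} (hD : vcDim (asSets H) + vcDim (marginClass U H) ≤ D) {k : ℕ}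
    (w : Fin k → X × Bool) :
    ((fun h => fun i => robustErr U h (w i)) '' H).ncard ≤ (k + 1) ^ D := by
  classical
  have hfin : vcDim (asSets H) + vcDim (marginClass U H) ≠ ⊤ :=
    (hD.trans_lt (ENat.natCast_lt_top D)).ne
  rw [Ne, ENat.add_eq_top, not_or] at hfin
  obtain ⟨d₁, h₁⟩ := ENat.ne_top_iff_exists.1 hfin.1
  obtain ⟨d₂, h₂⟩ := ENat.ne_top_iff_exists.1 hfin.2
  rw [← h₁, ← h₂] at hD
  have hdD : d₁ + d₂ ≤ D := by exact_mod_cast hD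
  set T₁ := (fun g : Set X => fun i => decide ((w i).1 ∈ g)) '' asSets H
  set T₂ := (fun g : Set (X × Bool) => fun i => decide (w i ∈ g)) '' marginClass U H
  -- The labels are fixed by w, so the two traces determine the loss pattern.
  have hsub : ((fun h => fun i => robustErr U h (w i)) '' H)
      ⊆ (fun q : (Fin k → Bool) × (Fin k → Bool) => fun i => ((q.1 i ^^ (w i).2) || q.2 i))
        '' (T₁ ×ˢ T₂) := by
    rintro _ ⟨h, hh, rfl⟩
    refine ⟨((fun g : Set X => fun i => decide ((w i).1 ∈ g)) {x | h x = true},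
      fun i => decide (w i ∈ marginArea U h)),
      ⟨⟨{x | h x = true}, ⟨h, hh, rfl⟩, rfl⟩, ⟨marginArea U h, ⟨h, hh, rfl⟩, rfl⟩⟩, ?_⟩
    funext i
    simp [robustErr_eq hU h (w i)]
  calc _ ≤ _ := Set.ncard_le_ncard hsub (Set.toFinite _)
    _ ≤ (T₁ ×ˢ T₂).ncard := Set.ncard_image_le (Set.toFinite _)
    _ = T₁.ncard * T₂.ncard := Set.ncard_prod
    _ ≤ (k + 1) ^ d₁ * (k + 1) ^ d₂ :=
      Nat.mul_le_mul (ncard_trace_le h₁.ge _) (ncard_trace_le h₂.ge _)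
    _ = (k + 1) ^ (d₁ + d₂) := (pow_add _ _ _).symm
    _ ≤ (k + 1) ^ D := Nat.pow_le_pow_right (Nat.succ_pos k) hdD

/-- The loss patterns of `H` on the sample `S`. -/
noncomputable def lossPatterns {X : Type*} (U : X → Set X) (H : Set (X → Bool)) {n : ℕ}
    (S : Fin n → X × Bool) : Finset (Fin n → Bool) :=
  (Set.toFinite ((fun h => fun i => robustErr U h (S i)) '' H)).toFinset

lemma mem_lossPatterns {X : Type*} {U : X → Set X} {H : Set (X → Bool)} {n : ℕ}
    {S : Fin n → X × Bool} {h : X → Bool} (hh : h ∈ H) :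
    (fun i => robustErr U h (S i)) ∈ lossPatterns U H S := by
  rw [lossPatterns, Set.Finite.mem_toFinset]
  exact ⟨h, hh, rfl⟩

/-- Choosing coordinates p of the sample S gives the tuple `S ∘ p`, to which the pattern count
applies directly. -/
lemma polyGrowth_lossPatterns {X : Type*} {U : X → Set X} (hU : ∀ x, x ∈ U x)
    {H : Set (X → Bool)} {D : ℕ} (hD : vcDim (asSets H) + vcDim (marginClass U H) ≤ D) {n : ℕ}
    (S : Fin n → X × Bool) : PolyGrowth D (lossPatterns U H S) := by
  intro k p
  have h := ncard_robustErr_le hU hD (S ∘ p)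
  have heq : (((lossPatterns U H S).image fun f => f ∘ p : Finset (Fin k → Bool)) :
      Set (Fin k → Bool)) = (fun h => fun i => robustErr U h ((S ∘ p) i)) '' H := by
    rw [Finset.coe_image, lossPatterns, Set.Finite.coe_toFinset, Set.image_image]
    rfl
  rw [← heq, Set.ncard_coe_finset] at h
  exact h

/-! ### Symmetrization -/

section Symmetrization

variable {X : Type*}

/-- Exchange the `i`-th entries of the two samples for all `i` with `σ i = false`. -/
def swapSamples {Z : Type*} {n : ℕ} (σ : Fin n → Bool) (q : (Fin n → Z) × (Fin n → Z)) :
    (Fin n → Z) × (Fin n → Z) :=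
  (fun i => if σ i then q.1 i else q.2 i, fun i => if σ i then q.2 i else q.1 i)

lemma measurePreserving_swapSamples {Z : Type*} [MeasurableSpace Z] (P : Measure Z)
    [IsProbabilityMeasure P] {n : ℕ} (σ : Fin n → Bool) :
    MeasurePreserving (swapSamples σ)
      ((Measure.pi fun _ : Fin n => P).prod (Measure.pi fun _ : Fin n => P))
      ((Measure.pi fun _ : Fin n => P).prod (Measure.pi fun _ : Fin n => P)) := by
  -- Viewed as a sequence of pairs, the exchange acts coordinatewise by the identity or the swap,
  -- both preserving P ⊗ P.
  have he := measurePreserving_arrowProdEquivProdArrow Z Z (Fin n) (fun _ => P) (fun _ => P)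
  have hs : MeasurePreserving
      (fun (a : Fin n → Z × Z) i => (if σ i then id else Prod.swap : Z × Z → Z × Z) (a i))
      (Measure.pi fun _ => P.prod P) (Measure.pi fun _ => P.prod P) := by
    refine measurePreserving_pi _ _ fun i => ?_
    cases σ i
    · simpa using Measure.measurePreserving_swap
    · simpa using MeasurePreserving.id (P.prod P)
  have hsymm := he.symm (MeasurableEquiv.arrowProdEquivProdArrow Z Z (Fin n))
  convert (he.comp hs).comp hsymm using 1
  funext q
  refine Prod.ext (funext fun i => ?_) (funext fun i => ?_) <;>
  cases hi : σ i <;>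
  simp [swapSamples, hi, MeasurableEquiv.arrowProdEquivProdArrow, Equiv.arrowProdEquivProdArrow]

/-- If for every point at most a fraction `c` of the exchanges leads into `G`, then `G` has
measure at most `c`. -/
lemma measure_le_of_card_swap_le {Z : Type*} [MeasurableSpace Z] (P : Measure Z)
    [IsProbabilityMeasure P] {n : ℕ} {G : Set ((Fin n → Z) × (Fin n → Z))}
    (hG : NullMeasurableSet G
      ((Measure.pi fun _ : Fin n => P).prod (Measure.pi fun _ : Fin n => P))) {c : ℝ}
    (hc : ∀ q, (Set.ncard {σ : Fin n → Bool | swapSamples σ q ∈ G} : ℝ) ≤ c * 2 ^ n) :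
    ((Measure.pi fun _ : Fin n => P).prod (Measure.pi fun _ : Fin n => P)) G
      ≤ ENNReal.ofReal c := by
  classical
  set μ := (Measure.pi fun _ : Fin n => P).prod (Measure.pi fun _ : Fin n => P) with hμ
  have hpre : ∀ σ : Fin n → Bool, NullMeasurableSet (swapSamples σ ⁻¹' G) μ := fun σ =>
    hG.preimage (measurePreserving_swapSamples P σ).quasiMeasurePreserving
  have h1 : ∀ σ : Fin n → Bool, μ G = ∫⁻ q, (swapSamples σ ⁻¹' G).indicator (fun _ => (1 : ENNReal)) q ∂μ := by
    intro σ
    rw [lintegral_indicator_const₀ (hpre σ), one_mul,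
      (measurePreserving_swapSamples P σ).measure_preimage hG]
  -- Summing over all exchanges moves the randomness to σ, so a pointwise count bounds the measure.
  have h2 : (2 ^ n : ENNReal) * μ G
      = ∫⁻ q, ∑ σ : Fin n → Bool, (swapSamples σ ⁻¹' G).indicator (fun _ => (1 : ENNReal)) q ∂μ := by
    rw [lintegral_finsetSum' _ fun σ _ =>
      aemeasurable_const.indicator₀ (hpre σ)]
    rw [← Finset.sum_congr rfl fun σ _ => h1 σ, Finset.sum_const, Finset.card_univ,
      Fintype.card_fun, Fintype.card_bool, Fintype.card_fin, nsmul_eq_mul]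
    push_cast
    rfl
  have h3 : ∀ q, ∑ σ : Fin n → Bool, (swapSamples σ ⁻¹' G).indicator (fun _ => (1 : ENNReal)) q
      ≤ ENNReal.ofReal (c * 2 ^ n) := by
    intro q
    have : ∑ σ : Fin n → Bool, (swapSamples σ ⁻¹' G).indicator (fun _ => (1 : ENNReal)) q
        = (Set.ncard {σ : Fin n → Bool | swapSamples σ q ∈ G} : ENNReal) := by
      simp only [Set.indicator_apply, Set.mem_preimage]
      rw [Finset.sum_boole, Set.ncard_eq_toFinset_card']
      congr 2
      ext σ
      simp
    rw [this, ← ENNReal.ofReal_natCast]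
    exact ENNReal.ofReal_le_ofReal (hc q)
  have h4 : (2 ^ n : ENNReal) * μ G ≤ ENNReal.ofReal (c * 2 ^ n) := by
    rw [h2]
    refine (lintegral_mono h3).trans ?_
    rw [lintegral_const, measure_univ, mul_one]
  rw [mul_comm c, ENNReal.ofReal_mul (by positivity), ENNReal.ofReal_pow (by norm_num),
    ENNReal.ofReal_ofNat] at h4
  exact (ENNReal.mul_le_mul_iff_right (by positivity) (by finiteness)).1 h4

lemma robustLoss_mem_Icc (U : X → Set X) (h : X → Bool) (p : X × Bool) :
    robustLoss U h p.1 p.2 ∈ Set.Icc (0 : ℝ) 1 := by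
  rw [robustLoss_eq]
  split_ifs <;> simp

lemma empLoss_mem_Icc (U : X → Set X) (h : X → Bool) {n : ℕ} (S : Fin n → X × Bool) :
    empLoss (robustLoss U) S h ∈ Set.Icc (0 : ℝ) 1 := by
  have h0 : 0 ≤ ∑ i, robustLoss U h (S i).1 (S i).2 :=
    Finset.sum_nonneg fun i _ => (robustLoss_mem_Icc U h (S i)).1
  have h1 : ∑ i, robustLoss U h (S i).1 (S i).2 ≤ n := by
    have := Finset.sum_le_sum fun i (_ : i ∈ Finset.univ) => (robustLoss_mem_Icc U h (S i)).2
    simpa using this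
  exact ⟨div_nonneg h0 (Nat.cast_nonneg n), div_le_one_of_le₀ h1 (Nat.cast_nonneg n)⟩

/-- The empirical loss depends only on the loss pattern, so it takes finitely many values. -/
lemma exists_minimal_empLoss (U : X → Set X) {H : Set (X → Bool)} (hH : H.Nonempty) {n : ℕ}
    (S : Fin n → X × Bool) :
    ∃ h ∈ H, ∀ g ∈ H, empLoss (robustLoss U) S h ≤ empLoss (robustLoss U) S g := by
  have hfin : ((empLoss (robustLoss U) S) '' H).Finite := by
    refine (Set.toFinite (Set.range fun f : Fin n → Bool => (∑ i, ind f i) / n)).subset ?_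
    rintro _ ⟨h, -, rfl⟩
    refine ⟨fun i => robustErr U h (S i), ?_⟩
    simp only [empLoss, robustLoss_eq, ind]
  obtain ⟨h, hh, hmin⟩ := Set.exists_min_image _ id hfin (hH.image _)
  obtain ⟨g, hg, rfl⟩ := hh
  exact ⟨g, hg, fun g' hg' => hmin _ ⟨g', hg', rfl⟩⟩

lemma exists_isERM (U : X → Set X) {H : Set (X → Bool)} (hH : H.Nonempty) :
    ∃ A : Learner X, A.IsERM H (robustLoss U) := by
  choose A hA hmin using fun (n : ℕ) (S : Fin n → X × Bool) => exists_minimal_empLoss U hH S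
  exact ⟨A, hA, hmin⟩

/-- The difference of the empirical losses on exchanged samples is a Rademacher average. -/
lemma empLoss_swapSamples_sub (U : X → Set X) (h : X → Bool) {n : ℕ} (σ : Fin n → Bool)
    (q : (Fin n → X × Bool) × (Fin n → X × Bool)) :
    empLoss (robustLoss U) (swapSamples σ q).1 h - empLoss (robustLoss U) (swapSamples σ q).2 h
      = (rad σ (ind fun i => robustErr U h (q.1 i)) - rad σ (ind fun i => robustErr U h (q.2 i)))
        / n := by
  rw [empLoss, empLoss, ← sub_div, ← rad_sub, rad, ← Finset.sum_sub_distrib]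
  congr 1
  refine Finset.sum_congr rfl fun i _ => ?_
  rw [robustLoss_eq, robustLoss_eq]
  cases hi : σ i <;> simp [swapSamples, ind, hi]

/-- The event that the empirical losses on two samples differ by `ε` for some hypothesis. -/
def deviationEvent (U : X → Set X) (H : Set (X → Bool)) (n : ℕ) (ε : ℝ) :
    Set ((Fin n → X × Bool) × (Fin n → X × Bool)) :=
  {q | ε ≤ ⨆ h : H, |empLoss (robustLoss U) q.1 (h : X → Bool)
    - empLoss (robustLoss U) q.2 (h : X → Bool)|}

lemma bddAbove_deviation (U : X → Set X) (H : Set (X → Bool)) {n : ℕ}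
    (S T : Fin n → X × Bool) :
    BddAbove (Set.range fun h : H => |empLoss (robustLoss U) S (h : X → Bool)
      - empLoss (robustLoss U) T (h : X → Bool)|) := by
  refine ⟨1, ?_⟩
  rintro _ ⟨h, rfl⟩
  have hS := empLoss_mem_Icc U h S
  have hT := empLoss_mem_Icc U h T
  exact abs_le.2 ⟨by linarith [hS.1, hT.2], by linarith [hS.2, hT.1]⟩

/-- Some h deviates by more than 2ε/3, which avoids attaining the supremum; hence one of the two
Rademacher sums is at least nε/3, and each sample contributes a fraction δ. -/
lemma ncard_swap_deviation_le {U : X → Set X} (hU : ∀ x, x ∈ U x) {H : Set (X → Bool)}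
    (hH : H.Nonempty) {D : ℕ} (hD : vcDim (asSets H) + vcDim (marginClass U H) ≤ D) {n : ℕ}
    {ε δ : ℝ} (hε : 0 < ε) (hδ0 : 0 < δ) (hδ1 : δ ≤ 1)
    (hn : 7680 * rateNum D δ ≤ (ε / 3) ^ 2 * n)
    (q : (Fin n → X × Bool) × (Fin n → X × Bool)) :
    (Set.ncard {σ : Fin n → Bool | swapSamples σ q ∈ deviationEvent U H n ε} : ℝ)
      ≤ 2 * δ * 2 ^ n := by
  have : Nonempty H := hH.to_subtype
  set A : (Fin n → X × Bool) → Finset (Fin n → Bool) := fun S =>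
    Finset.univ.filter fun σ => ∃ f ∈ lossPatterns U H S, ε / 3 * n ≤ |rad σ (ind f)| with hA
  have hcard : ∀ S, ((A S).card : ℝ) ≤ δ * 2 ^ n := by
    intro S
    have := card_exists_abs_rad_le (polyGrowth_lossPatterns hU hD S) (ε := ε / 3)
      (by positivity) hδ0 hδ1 (by simpa using hn)
    simpa using this
  have hsub : {σ : Fin n → Bool | swapSamples σ q ∈ deviationEvent U H n ε}
      ⊆ ((A q.1 ∪ A q.2 : Finset (Fin n → Bool)) : Set (Fin n → Bool)) := by
    intro σ hσ
    have hlt : ε * (2 / 3) < _ := lt_of_lt_of_le (by linarith) hσ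
    obtain ⟨⟨h, hh⟩, hdev⟩ := exists_lt_of_lt_ciSup hlt
    rw [empLoss_swapSamples_sub, abs_div, Nat.abs_cast] at hdev
    -- For n = 0 division by zero makes the deviation 0.
    have hn0 : (0 : ℝ) < n := by
      refine (Nat.cast_nonneg n).lt_of_ne' fun h0 => ?_
      rw [h0, div_zero] at hdev
      linarith
    rw [lt_div_iff₀ hn0] at hdev
    have htri := abs_sub (rad σ (ind fun i => robustErr U h (q.1 i)))
      (rad σ (ind fun i => robustErr U h (q.2 i)))
    simp only [hA, Finset.coe_union, Finset.coe_filter, Finset.mem_univ, true_and, Set.mem_union,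
      Set.mem_ofPred_eq]
    by_cases hc : ε / 3 * n ≤ |rad σ (ind fun i => robustErr U h (q.1 i))|
    · exact Or.inl ⟨_, mem_lossPatterns hh, hc⟩
    · refine Or.inr ⟨_, mem_lossPatterns hh, ?_⟩
      push Not at hc
      linarith
  have hle := Set.ncard_le_ncard hsub (Finset.finite_toSet _)
  rw [Set.ncard_coe_finset] at hle
  have hle' : (Set.ncard {σ : Fin n → Bool | swapSamples σ q ∈ deviationEvent U H n ε} : ℝ)
      ≤ (A q.1).card + (A q.2).card := by exact_mod_cast hle.trans (Finset.card_union_le _ _)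
  linarith [hcard q.1, hcard q.2]

variable [MeasurableSpace X]

/-- Chebyshev's inequality for the empirical loss of a single hypothesis. -/
lemma measure_abs_empLoss_sub_le {U : X → Set X} {h : X → Bool}
    (hm : Measurable fun p : X × Bool => robustLoss U h p.1 p.2) (P : Measure (X × Bool))
    [IsProbabilityMeasure P] {n : ℕ} {ε : ℝ} (hε : 0 < ε) (hn : 1 ≤ 2 * (n * ε ^ 2)) :
    (Measure.pi fun _ : Fin n => P)
      {T | ε ≤ |empLoss (robustLoss U) T h - trueLoss (robustLoss U) P h|} ≤ 1 / 2 := by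
  have hn0 : (0 : ℝ) < n := by
    rcases Nat.eq_zero_or_pos n with h0 | h0
    · rw [h0] at hn
      norm_num at hn
    · exact_mod_cast h0
  set f : X × Bool → ℝ := fun p => robustLoss U h p.1 p.2 with hf
  have hmem : MemLp f 2 P :=
    MemLp.of_bound hm.aestronglyMeasurable 1 (ae_of_all _ fun p => by
      have := robustLoss_mem_Icc U h p
      rw [Real.norm_eq_abs, abs_of_nonneg this.1]
      exact this.2)
  have hcomp : ∀ i : Fin n, MemLp (fun T : Fin n → X × Bool => f (T i)) 2
      (Measure.pi fun _ => P) := fun i =>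
    hmem.comp_measurePreserving (measurePreserving_eval (fun _ : Fin n => P) i)
  have hsum : MemLp (∑ i : Fin n, fun T : Fin n → X × Bool => f (T i)) 2
      (Measure.pi fun _ => P) := memLp_finsetSum' _ fun i _ => hcomp i
  have hvar : ProbabilityTheory.variance (∑ i : Fin n, fun T : Fin n → X × Bool => f (T i))
      (Measure.pi fun _ => P) ≤ n / 4 := by
    rw [ProbabilityTheory.variance_sum_pi fun _ => hmem]
    have h1 := ProbabilityTheory.variance_le_sq_of_bounded
      (ae_of_all P fun p => robustLoss_mem_Icc U h p) hm.aemeasurable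
    have h2 := Finset.sum_le_sum fun (i : Fin n) (_ : i ∈ Finset.univ) => h1
    refine h2.trans (le_of_eq ?_)
    rw [Finset.sum_const, Finset.card_univ, Fintype.card_fin, nsmul_eq_mul]
    ring
  have hint : ∫ T, (∑ i : Fin n, fun T : Fin n → X × Bool => f (T i)) T
      ∂(Measure.pi fun _ => P) = n * trueLoss (robustLoss U) P h := by
    simp only [Finset.sum_apply]
    rw [integral_finsetSum _ fun i _ => (hcomp i).integrable (by norm_num)]
    simp_rw [integral_comp_eval (μ := fun _ : Fin n => P) hm.aestronglyMeasurable]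
    rw [Finset.sum_const, Finset.card_univ, Fintype.card_fin, nsmul_eq_mul]
    rfl
  -- The bound is at most (n/4)/(nε)² = 1/(4nε²) ≤ 1/2.
  have hcheb := ProbabilityTheory.meas_ge_le_variance_div_sq hsum (c := n * ε) (by positivity)
  rw [hint] at hcheb
  have hset : {T : Fin n → X × Bool |
        ε ≤ |empLoss (robustLoss U) T h - trueLoss (robustLoss U) P h|}
      = {T | n * ε ≤ |(∑ i : Fin n, fun T : Fin n → X × Bool => f (T i)) T
        - n * trueLoss (robustLoss U) P h|} := by
    ext T
    simp only [Set.mem_ofPred_eq, Finset.sum_apply, empLoss]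
    have : (∑ i, robustLoss U h (T i).1 (T i).2) / n - trueLoss (robustLoss U) P h
        = (∑ i, f (T i) - n * trueLoss (robustLoss U) P h) / n := by
      rw [hf]
      field_simp
    rw [this, abs_div, Nat.abs_cast, le_div_iff₀ hn0, mul_comm ε]
  rw [hset]
  refine hcheb.trans ?_
  rw [show (1 / 2 : ENNReal) = ENNReal.ofReal (1 / 2) by
    rw [ENNReal.ofReal_div_of_pos two_pos]; simp]
  apply ENNReal.ofReal_le_ofReal
  rw [div_le_iff₀ (by positivity)]
  nlinarith

/-- **Symmetrization**: deviations from the true loss are controlled by those between two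
independent samples. -/
lemma measure_exists_abs_sub_le {U : X → Set X} {H : Set (X → Bool)}
    (hm : ∀ h ∈ H, Measurable fun p : X × Bool => robustLoss U h p.1 p.2)
    (P : Measure (X × Bool)) [IsProbabilityMeasure P] {n : ℕ} {ε : ℝ} (hε : 0 < ε)
    (hn : 1 ≤ 2 * (n * ε ^ 2)) :
    (Measure.pi fun _ : Fin n => P)
      {S | ∃ h ∈ H, 2 * ε < |empLoss (robustLoss U) S h - trueLoss (robustLoss U) P h|}
      ≤ 2 * ((Measure.pi fun _ : Fin n => P).prod (Measure.pi fun _ : Fin n => P))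
        (deviationEvent U H n ε) := by
  set μ := Measure.pi fun _ : Fin n => P with hμ
  -- The measurable hull has the same measure and admits Fubini and Markov.
  set G := toMeasurable (μ.prod μ) (deviationEvent U H n ε) with hG
  have hGm : MeasurableSet G := measurableSet_toMeasurable _ _
  have hsub : {S | ∃ h ∈ H, 2 * ε < |empLoss (robustLoss U) S h - trueLoss (robustLoss U) P h|}
      ⊆ {S | 1 / 2 ≤ μ (Prod.mk S ⁻¹' G)} := by
    rintro S ⟨h, hh, hS⟩
    have hcheb := measure_abs_empLoss_sub_le (hm h hh) P hε hn
    -- S is off by more than 2ε and T by less than ε, so their empirical losses differ by more than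
    -- ε.
    have hset : {T | ε ≤ |empLoss (robustLoss U) T h - trueLoss (robustLoss U) P h|}ᶜ
        ⊆ Prod.mk S ⁻¹' G := by
      intro T hT
      refine subset_toMeasurable _ _ ?_
      refine le_trans ?_ (le_ciSup (bddAbove_deviation U H S T) ⟨h, hh⟩)
      simp only [Set.mem_compl_iff, Set.mem_ofPred_eq, not_le] at hT
      have := abs_sub_le (empLoss (robustLoss U) S h) (empLoss (robustLoss U) T h)
        (trueLoss (robustLoss U) P h)
      dsimp only
      linarith
    have hone : (1 : ENNReal) ≤ μ {T | ε ≤ |empLoss (robustLoss U) T h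
          - trueLoss (robustLoss U) P h|}
        + μ {T | ε ≤ |empLoss (robustLoss U) T h - trueLoss (robustLoss U) P h|}ᶜ := by
      rw [← measure_univ (μ := μ), ← Set.union_compl_self]
      exact measure_union_le _ _
    have hle : (1 : ENNReal) ≤ 1 / 2 + μ (Prod.mk S ⁻¹' G) :=
      hone.trans (add_le_add hcheb (measure_mono hset))
    have hhalf : (1 / 2 : ENNReal) + 1 / 2 ≤ 1 / 2 + μ (Prod.mk S ⁻¹' G) :=
      (ENNReal.add_halves 1).le.trans hle
    exact (ENNReal.add_le_add_iff_left (by finiteness)).1 hhalf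
  have hmarkov := mul_meas_ge_le_lintegral₀
    (measurable_measure_prodMk_left (ν := μ) hGm).aemeasurable (μ := μ) (1 / 2)
  rw [← Measure.prod_apply hGm, hG, measure_toMeasurable, ← hG] at hmarkov
  calc _ ≤ μ {S | 1 / 2 ≤ μ (Prod.mk S ⁻¹' G)} := measure_mono hsub
    _ = 2 * (1 / 2 * μ {S | 1 / 2 ≤ μ (Prod.mk S ⁻¹' G)}) := by
      rw [← mul_assoc, one_div, ENNReal.mul_inv_cancel two_ne_zero ENNReal.ofNat_ne_top, one_mul]
    _ ≤ _ := by gcongr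

/-- **Uniform convergence** of the empirical robust losses. -/
theorem measure_exists_deviation_le {U : X → Set X} (hU : ∀ x, x ∈ U x) {H : Set (X → Bool)}
    (hH : H.Nonempty) (hm : ∀ h ∈ H, Measurable fun p : X × Bool => robustLoss U h p.1 p.2)
    (hW : WellBehaved H (robustLoss U)) {D : ℕ}
    (hD : vcDim (asSets H) + vcDim (marginClass U H) ≤ D) (P : Measure (X × Bool))
    [IsProbabilityMeasure P] {n : ℕ} {ε δ : ℝ} (hε : 0 < ε) (hδ0 : 0 < δ) (hδ1 : δ ≤ 1)
    (hn : 829440 * rateNum D δ ≤ ε ^ 2 * n) :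
    (Measure.pi fun _ : Fin n => P)
      {S | ∃ h ∈ H, ε < |empLoss (robustLoss U) S h - trueLoss (robustLoss U) P h|}
      ≤ ENNReal.ofReal δ := by
  have hlog : (1 / 2 : ℝ) ≤ Real.log 2 := by linarith [Real.log_two_gt_d9]
  have hB := log_two_le_rateNum D hδ0 hδ1
  have hB4 : rateNum D (δ / 4) ≤ 3 * rateNum D δ := by
    have h1 := Real.log_nonpos hδ0.le hδ1
    have h2 := natCast_mul_log_nonneg D
    rw [rateNum, rateNum, log_two_div hδ0, log_two_div (by positivity),
      Real.log_div hδ0.ne' (by norm_num), log_four]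
    linarith
  have h := measure_exists_abs_sub_le hm P (half_pos hε) (n := n) (by nlinarith)
  rw [mul_div_cancel₀ _ (two_ne_zero' ℝ)] at h
  refine h.trans ?_
  -- Regularity enters here: averaging over exchanges integrates the indicator of this event.
  have hG : NullMeasurableSet (deviationEvent U H n (ε / 2))
      ((Measure.pi fun _ : Fin n => P).prod (Measure.pi fun _ : Fin n => P)) :=
    (hW P inferInstance n).nullMeasurableSet_preimage measurableSet_Ici
  -- δ/4 pays for the factor 2 of symmetrization and the two samples. 829440 = 7680 · 36 · 3: the
  -- deviation ε/2 is cut to ε/6, and passing to δ/4 at most triples the rate.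
  have h2 := measure_le_of_card_swap_le P hG (c := 2 * (δ / 4)) fun q =>
    ncard_swap_deviation_le hU hH hD (half_pos hε) (by positivity) (by linarith)
      (by nlinarith) q
  calc _ ≤ 2 * ENNReal.ofReal (2 * (δ / 4)) := by gcongr
    _ = ENNReal.ofReal δ := by
      rw [← ENNReal.ofReal_ofNat 2, ← ENNReal.ofReal_mul (by norm_num)]
      congr 1
      ring

/-! ### Learning guarantees -/

/-- On samples with small uniform deviations, empirical risk minimizers are nearly optimal. -/
lemma trueLoss_le_of_isERM {U : X → Set X} {H : Set (X → Bool)} (hH : H.Nonempty)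
    {A : Learner X} (hA : A.IsERM H (robustLoss U)) {P : Measure (X × Bool)} {n : ℕ}
    {S : Fin n → X × Bool} {ε : ℝ}
    (hS : ∀ h ∈ H, |empLoss (robustLoss U) S h - trueLoss (robustLoss U) P h| ≤ ε / 2) :
    trueLoss (robustLoss U) P (A n S) ≤ approxError (robustLoss U) P H + ε := by
  have : Nonempty H := hH.to_subtype
  rw [← sub_le_iff_le_add]
  refine le_ciInf fun h => ?_
  have h1 := abs_le.1 (hS _ (hA.1 n S))
  have h2 := abs_le.1 (hS h h.2)
  have h3 := hA.2 n S h h.2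
  linarith [h1.1, h2.2]

theorem agnosticallyLearns_of_isERM {U : X → Set X} (hU : ∀ x, x ∈ U x) {H : Set (X → Bool)}
    (hH : H.Nonempty) (hm : ∀ h ∈ H, Measurable fun p : X × Bool => robustLoss U h p.1 p.2)
    (hW : WellBehaved H (robustLoss U)) {D : ℕ}
    (hD : vcDim (asSets H) + vcDim (marginClass U H) ≤ D) {A : Learner X}
    (hA : A.IsERM H (robustLoss U)) {m : ℝ → ℝ → ℕ}
    (hmn : ∀ ε ∈ Set.Ioo (0 : ℝ) 1, ∀ δ ∈ Set.Ioo (0 : ℝ) 1,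
      3317760 * (rateNum D δ / ε ^ 2) ≤ m ε δ) :
    A.AgnosticallyLearns H (robustLoss U) (allDistributions X) m := by
  intro ε hε δ hδ P hP n hn
  have : IsProbabilityMeasure P := hP
  -- Deviations of ε/2 cost a factor 4: 3317760 = 4 · 829440.
  have hn' : (829440 : ℝ) * rateNum D δ ≤ (ε / 2) ^ 2 * n := by
    have h1 : 3317760 * (rateNum D δ / ε ^ 2) ≤ n :=
      (hmn ε hε δ hδ).trans (by exact_mod_cast hn)
    have hε2 : 0 < ε ^ 2 := pow_pos hε.1 2
    rw [← mul_div_assoc, div_le_iff₀ hε2] at h1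
    linarith
  refine le_trans (measure_mono ?_)
    (measure_exists_deviation_le hU hH hm hW hD P (half_pos hε.1) hδ.1 hδ.2.le hn')
  intro S hS
  by_contra hcon
  simp only [Set.mem_ofPred_eq, not_exists, not_and, not_lt] at hcon
  exact absurd (trueLoss_le_of_isERM hH hA hcon) (not_le.2 hS)

end Symmetrization

end RobustLearning

open RobustLearning in
/-- Proper robust learnability for finite VC-dimension and finite margin-VC-dimension; the
constant `C` is universal. -/
theorem theorem3p2 :
    ∃ C : ℝ, 0 < C ∧
      ∀ (X : Type*) [MeasurableSpace X] (H : Set (X → Bool)) (U : X → Set X),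
        H.Nonempty →
        (∀ h ∈ H, Measurable h) →
        (∀ x, x ∈ U x) →
        (∀ h ∈ H, Measurable fun p : X × Bool => robustLoss U h p.1 p.2) →
        WellBehaved H (robustLoss U) →
        vcDim (asSets H) < ⊤ →
        vcDim (marginClass U H) < ⊤ →
        ∀ D : ℕ, (D : ℕ∞) = vcDim (asSets H) + vcDim (marginClass U H) →
          ∃ m : ℝ → ℝ → ℕ,
            (∀ ε ∈ Set.Ioo (0 : ℝ) 1, ∀ δ ∈ Set.Ioo (0 : ℝ) 1,
              (m ε δ : ℝ) ≤ C * ((D * Real.log D + Real.log (2 / δ)) / ε ^ 2)) ∧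
            ProperlyLearnableWith H (robustLoss U) (allDistributions X) m ∧
            (∃ A : Learner X, A.IsERM H (robustLoss U)) ∧
            ∀ A : Learner X, A.IsERM H (robustLoss U) →
              A.AgnosticallyLearns H (robustLoss U) (allDistributions X) m := by
  -- The extra 2 absorbs the rounding up, since the rate divided by ε² is at least 1/2.
  refine ⟨3317762, by norm_num, ?_⟩
  intro X _ H U hH _ hU hm hW _ _ D hD
  have hlearn : ∀ A : Learner X, A.IsERM H (robustLoss U) →
      A.AgnosticallyLearns H (robustLoss U) (allDistributions X)
        fun ε δ => ⌈3317760 * (rateNum D δ / ε ^ 2)⌉₊ := fun A hA =>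
    agnosticallyLearns_of_isERM hU hH hm hW hD.ge hA fun ε _ δ _ => Nat.le_ceil _
  obtain ⟨A, hA⟩ := exists_isERM U hH
  refine ⟨fun ε δ => ⌈3317760 * (rateNum D δ / ε ^ 2)⌉₊, ?_, ⟨A, hA.1, hlearn A hA⟩,
    ⟨A, hA⟩, hlearn⟩
  intro ε hε δ hδ
  have hlog : (1 / 2 : ℝ) ≤ Real.log 2 := by linarith [Real.log_two_gt_d9]
  have hB := log_two_le_rateNum D hδ.1 hδ.2.le
  have hε2 : 0 < ε ^ 2 := pow_pos hε.1 2
  have hε1 : ε ^ 2 ≤ 1 := pow_le_one₀ hε.1.le hε.2.le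
  have hhalf : 1 / 2 ≤ rateNum D δ / ε ^ 2 := by
    rw [le_div_iff₀ hε2]
    linarith
  have hceil := Nat.ceil_lt_add_one (show 0 ≤ 3317760 * (rateNum D δ / ε ^ 2) by linarith)
  change _ ≤ 3317762 * (rateNum D δ / ε ^ 2)
  linarith
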